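/- Let $W_1,W_2,\overline W$ be separable real Hilbert spaces, with $W_1\subset\overline W$ a linear subspace that is dense in the norm of $\overline W$. Let $A$ be a linear operator such that $A:W_1\to W_2$ is bounded and injective, with adjoint $A^*:W_2\to W_1$, and $A$ extends to a continuous linear operator $A:\overline W\to W_2$, with $\|Af\|_{W_2}\le c\,\|f\|_{\overline W}$ for all $f\in\overline W$, where $c>0$. Let $\mathbb W=(\mathbb W(\varphi):\varphi\in W_2)$ be a centred Gaussian white noise process on a probability space $(\Omega,\Sigma,\mathbb P)$, that is, a centred Gaussian process with covariance $\mathbb E[\mathbb W(\varphi)\mathbb W(\varphi')]=\langle\varphi,\varphi'\rangle_{W_2}$. For $f\in\overline W$ and $\varepsilon>0$ let $P_f^M$ be the law, on $\mathbb R^{W_2}$ with the cylindrical $\sigma$-algebra, of $$M_\varepsilon=Af+\varepsilon\mathbb W,\qquad M_\varepsilon(\varphi)=\langle Af,\varphi\rangle_{W_2}+\varepsilon\,\mathbb W(\varphi),\quad \varphi\in W_2 .$$ Let $\Pi$ be a centred Gaussian Borel probability measure on $\overline W$ with reproducing kernel Hilbert space (Cameron--Martin space) $V_\Pi=\{h\in\overline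 W:\|h\|_{V_\Pi}<\infty\}$, where $\|h\|_{V_\Pi}=\sup\{l(h): l\in\overline W^{\,*},\ \|l\|_{L^2(\Pi)}\le 1\}$. Let $\Pi(\cdot\,|\,M_\varepsilon)$ be the posterior distribution, i.e. the regular conditional distribution of $f$ given $M_\varepsilon$ when $f\sim\Pi$ and $M_\varepsilon\,|\,f\sim P_f^M$. Fix $f^\dagger\in\overline W$ and let $$\phi_{\Pi,f^\dagger}(\delta)=\inf_{g\in V_\Pi,\ \|g-f^\dagger\|_{\overline W}\le\delta}\frac{\|g\|_{V_\Pi}^2}{2}-\log\Pi\big(f:\|f\|_{\overline W}\le\delta\big)\in[0,\infty],\qquad \inf\emptyset=+\infty .$$ Assume that there are $\delta_\varepsilon\to0$ with $\delta_\varepsilon/\varepsilon\to\infty$ as $\varepsilon\to0^+$ such that, for all sufficiently small $\varepsilon>0$, $$\phi_{\Pi,f^\dagger}\Big(\frac{\delta_\varepsilon}{2c}\Big)\le\Big(\frac{\delta_\varepsilon}{\varepsilon}\Big)^2 .$$ Let $\psi\in W_1$ be such that, for some constant $C$, $|\langle\psi,\varphi\rangle_{W_1}|\le C\|\varphi\|_{\overline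 W}$ for all $\varphi\in W_1$, and denote by $\langle f,\psi\rangle_{W_1}$, $f\in\overline W$, the continuous extension to $\overline W$ of the functional $\langle\cdot,\psi\rangle_{W_1}$. Suppose that $\psi=-A^*A\widetilde\psi$ for some $\widetilde\psi\in V_\Pi$. Put $$\widehat\Psi=\langle f^\dagger,\psi\rangle_{W_1}-\varepsilon\,\mathbb W(A\widetilde\psi).$$ Then, when the data are $M_\varepsilon=Af^\dagger+\varepsilon\mathbb W$, $$\mathcal L\big(\varepsilon^{-1}(\langle f,\psi\rangle_{W_1}-\widehat\Psi)\,\big|\,M_\varepsilon\big)\ \longrightarrow\ \mathcal N\big(0,\|A\widetilde\psi\|_{W_2}^2\big)$$ weakly in $P_{f^\dagger}^M$-probability as $\varepsilon\to0^+$: for every metric $d$ that metrizes weak convergence of probability measures on $\mathbb R$, the $d$-distance between the two sides tends to $0$ in $P_{f^\dagger}^M$-probability. (If $A\widetilde\psi=0$, the limit is the Dirac measure at $0$.) -/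

import Mathlib

open MeasureTheory ProbabilityTheory Filter Topology
open scoped ENNReal NNReal InnerProductSpace

namespace InverseBvM

/-- `W` is a centred Gaussian white noise process indexed by the Hilbert space `H`, on the
probability space `(Ω, P)`: a centred Gaussian process with covariance
`E (W φ * W φ') = ⟪φ, φ'⟫`. -/
structure IsWhiteNoise {H Ω : Type*} [NormedAddCommGroup H] [InnerProductSpace ℝ H]
    [MeasurableSpace Ω] (W : H → Ω → ℝ) (P : Measure Ω) : Prop where
  measurable : ∀ φ, Measurable (W φ)
  gaussian : IsGaussianProcess W P
  mean_zero : ∀ φ, ∫ ω, W φ ω ∂P = 0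
  covariance : ∀ φ φ', ∫ ω, W φ ω * W φ' ω ∂P = ⟪φ, φ'⟫_ℝ

section Observation

variable {H V Ω : Type*} [NormedAddCommGroup H] [InnerProductSpace ℝ H]
  [NormedAddCommGroup V] [InnerProductSpace ℝ V]

/-- The observation `M = A f + ε W`, as the real-valued process
`φ ↦ ⟪A f, φ⟫ + ε * W φ` indexed by `H`, i.e. an element of `H → ℝ` (with the product, that is
cylindrical, σ-algebra) for each `ω`. -/
def obs (A : V →L[ℝ] H) (W : H → Ω → ℝ) (ε : ℝ) (f : V) (ω : Ω) : H → ℝ :=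
  fun φ => ⟪A f, φ⟫_ℝ + ε * W φ ω

theorem measurable_obs [MeasurableSpace Ω] [MeasurableSpace V] [BorelSpace V]
    (A : V →L[ℝ] H) {W : H → Ω → ℝ} (hW : ∀ φ, Measurable (W φ)) (ε : ℝ) :
    Measurable (fun p : V × Ω => obs A W ε p.1 p.2) := by
  refine measurable_pi_lambda _ fun φ => ?_
  have h1 : Measurable fun f : V => ⟪A f, φ⟫_ℝ :=
    (A.continuous.inner continuous_const).measurable
  exact (h1.comp measurable_fst).add (((hW φ).comp measurable_snd).const_mul ε)

/-- The statistical model: the Markov kernel sending the unknown `f` to the law `P_f` of the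
observation `A f + ε W` (a probability measure on `H → ℝ`). -/
noncomputable def model [MeasurableSpace Ω] [MeasurableSpace V] [BorelSpace V]
    (A : V →L[ℝ] H) {W : H → Ω → ℝ} (hW : ∀ φ, Measurable (W φ))
    (P : Measure Ω) [IsProbabilityMeasure P] (ε : ℝ) : Kernel V (H → ℝ) where
  toFun f := P.map (obs A W ε f)
  measurable' := by
    refine Measure.measurable_of_measurable_coe _ fun s hs => ?_
    have hm := measurable_obs A hW ε
    have : (fun f : V => (P.map (obs A W ε f)) s) =
        fun f => P (Prod.mk f ⁻¹' ((fun p : V × Ω => obs A W ε p.1 p.2) ⁻¹' s)) := by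
      funext f
      have hf : Measurable (obs A W ε f) := hm.comp measurable_prodMk_left
      rw [Measure.map_apply hf hs]
      rfl
    rw [this]
    exact measurable_measure_prodMk_left (hm hs)

instance [MeasurableSpace Ω] [MeasurableSpace V] [BorelSpace V]
    (A : V →L[ℝ] H) {W : H → Ω → ℝ} (hW : ∀ φ, Measurable (W φ))
    (P : Measure Ω) [IsProbabilityMeasure P] (ε : ℝ) : IsMarkovKernel (model A hW P ε) :=
  ⟨fun _ => Measure.isProbabilityMeasure_map
    ((measurable_obs A hW ε).comp measurable_prodMk_left).aemeasurable⟩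

theorem standardBorelSpace_of_separable {E : Type*} [NormedAddCommGroup E] [CompleteSpace E]
    [TopologicalSpace.SeparableSpace E] [MeasurableSpace E] [BorelSpace E] :
    StandardBorelSpace E := by
  have := UniformSpace.secondCountable_of_separable E
  infer_instance

/-- The posterior distribution `Π(· | M)`: the conditional distribution of `f` given the
observation in the Bayesian model `f ∼ Π`, `M | f ∼ P_f`, as a Markov kernel from the space of
observations to the parameter space. It is unique up to null sets of the marginal law of the
observation, and every `P_f` is absolutely continuous with respect to that law. -/
noncomputable def posteriorLaw [CompleteSpace V] [TopologicalSpace.SeparableSpace V]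
    [MeasurableSpace Ω] [MeasurableSpace V] [BorelSpace V]
    (A : V →L[ℝ] H) {W : H → Ω → ℝ} (hW : ∀ φ, Measurable (W φ))
    (P : Measure Ω) [IsProbabilityMeasure P] (prior : Measure V) [IsFiniteMeasure prior]
    (ε : ℝ) : Kernel (H → ℝ) V :=
  haveI := standardBorelSpace_of_separable (E := V)
  posterior (model A hW P ε) prior

instance [CompleteSpace V] [TopologicalSpace.SeparableSpace V]
    [MeasurableSpace Ω] [MeasurableSpace V] [BorelSpace V]
    (A : V →L[ℝ] H) {W : H → Ω → ℝ} (hW : ∀ φ, Measurable (W φ))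
    (P : Measure Ω) [IsProbabilityMeasure P] (prior : Measure V) [IsFiniteMeasure prior]
    (ε : ℝ) : IsMarkovKernel (posteriorLaw A hW P prior ε) := by
  have := standardBorelSpace_of_separable (E := V)
  unfold posteriorLaw
  infer_instance

end Observation

section RKHS

variable {V : Type*} [NormedAddCommGroup V] [InnerProductSpace ℝ V] [MeasurableSpace V]

/-- The Cameron–Martin (RKHS) norm of a centred Gaussian measure `Π`, with values in `[0, ∞]`:
`sup {l h : l a continuous linear functional with ‖l‖_{L²(Π)} ≤ 1}`. -/
noncomputable def rkhsNorm (prior : Measure V) (h : V) : ℝ≥0∞ :=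
  ⨆ (l : V →L[ℝ] ℝ) (_ : eLpNorm l 2 prior ≤ 1), ENNReal.ofReal (l h)

/-- The Cameron–Martin space (RKHS) of a centred Gaussian measure. -/
def rkhs (prior : Measure V) : Set V := {h | rkhsNorm prior h < ∞}

/-- The concentration function
`φ(δ) = inf {‖g‖²_RKHS / 2 : g ∈ RKHS, ‖g - f₀‖ ≤ δ} - log Π(f : ‖f‖ ≤ δ)`,
extended-real valued (an infimum over the empty set is `+∞`, and `log 0 = -∞`). -/
noncomputable def concentrationFn (prior : Measure V) (f₀ : V) (δ : ℝ) : EReal :=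
  ((⨅ g ∈ {g : V | g ∈ rkhs prior ∧ ‖g - f₀‖ ≤ δ}, rkhsNorm prior g ^ 2 / 2 : ℝ≥0∞) : EReal)
    - ENNReal.log (prior {f : V | ‖f‖ ≤ δ})

/-- The concentration-function condition: there are `δ_ε → 0` with `δ_ε / ε → ∞` as `ε → 0+`
and `φ(δ_ε / (2c)) ≤ (δ_ε / ε)²` (for all small `ε > 0`). -/
def ConcentrationCondition (prior : Measure V) (f₀ : V) (c : ℝ) : Prop :=
  ∃ δ : ℝ → ℝ, Tendsto δ (𝓝[>] 0) (𝓝 0) ∧ Tendsto (fun ε => δ ε / ε) (𝓝[>] 0) atTop ∧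
    ∀ᶠ ε in 𝓝[>] (0 : ℝ),
      concentrationFn prior f₀ (δ ε / (2 * c)) ≤ (((δ ε / ε) ^ 2 : ℝ) : EReal)

end RKHS

section Functional

variable {W₁ V : Type*} [NormedAddCommGroup W₁] [InnerProductSpace ℝ W₁]
  [NormedAddCommGroup V] [InnerProductSpace ℝ V]

/-- The continuous extension to `V` of the functional `⟪ψ, ·⟫` on `W₁`, where `W₁` is identified
with a dense subspace of `V` through `ι` and `|⟪ψ, φ⟫| ≤ C * ‖ι φ‖` for some `C` and all `φ`. -/
noncomputable def pairing (ι : W₁ →ₗ[ℝ] V) (ψ : W₁) : V →L[ℝ] ℝ :=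
  LinearMap.extendOfNorm (innerSL ℝ ψ : W₁ →L[ℝ] ℝ).toLinearMap ι

end Functional

/-- The random probability measures `μ ε` on `ℝ` converge weakly to `ν` in `P`-probability as
`ε → 0+`: for any metric `d` for weak convergence of probability measures, `d (μ ε) ν` converges
to `0` in probability. -/
def TendstoWeaklyInProbability {Ω : Type*} [MeasurableSpace Ω] (P : Measure Ω)
    (μ : ℝ → Ω → ProbabilityMeasure ℝ) (ν : ProbabilityMeasure ℝ) : Prop :=
  ∀ d : MetricSpace (ProbabilityMeasure ℝ),
    d.toPseudoMetricSpace.toUniformSpace.toTopologicalSpace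
      = (ProbabilityMeasure.instTopologicalSpace : TopologicalSpace (ProbabilityMeasure ℝ)) →
    ∀ η : ℝ, 0 < η →
      Tendsto (fun ε => P {ω | η ≤ d.dist (μ ε ω) ν}) (𝓝[>] 0) (𝓝 0)

section Main

variable {W₁ V H Ω : Type*} [NormedAddCommGroup W₁] [InnerProductSpace ℝ W₁]
  [NormedAddCommGroup V] [InnerProductSpace ℝ V] [CompleteSpace V]
  [TopologicalSpace.SeparableSpace V] [MeasurableSpace V] [BorelSpace V]
  [NormedAddCommGroup H] [InnerProductSpace ℝ H] [MeasurableSpace Ω]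

/-- The centring `⟨f₀, ψ⟩ - ε ⟨A ψ', W⟩`, a random variable on `Ω`. -/
noncomputable def centring (ι : W₁ →ₗ[ℝ] V) (A : V →L[ℝ] H) (W : H → Ω → ℝ) (f₀ : V) (ψ : W₁)
    (ψ' : V) (ε : ℝ) (ω : Ω) : ℝ :=
  pairing ι ψ f₀ - ε * W (A ψ') ω

/-- The law of `ε⁻¹ (⟨f, ψ⟩ - Ψ)` for `f` drawn from the posterior given the observation
`M_ε(ω) = A f₀ + ε W(ω)`, where `Ψ` is `centring`; a random probability measure on `ℝ`. -/
noncomputable def scaledPosterior (ι : W₁ →ₗ[ℝ] V) (A : V →L[ℝ] H) {W : H → Ω → ℝ}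
    (hW : ∀ φ, Measurable (W φ)) (P : Measure Ω) [IsProbabilityMeasure P]
    (prior : Measure V) [IsFiniteMeasure prior] (f₀ : V) (ψ : W₁) (ψ' : V) (ε : ℝ) (ω : Ω) :
    ProbabilityMeasure ℝ :=
  ⟨(posteriorLaw A hW P prior ε (obs A W ε f₀ ω)).map
      (fun f => ε⁻¹ * (pairing ι ψ f - centring ι A W f₀ ψ ψ' ε ω)),
    Measure.isProbabilityMeasure_map (by fun_prop)⟩

end Main

end InverseBvM

/-! The model is conjugate, so the posterior of a linear functional is exactly Gaussian and only its
mean and variance have to be followed. With u = A ψ', the source condition turns ⟨f, ψ⟩ into -⟨A f,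
u⟩ (`pairing_eq_neg_inner`). Let T χ = ⟨A ·, χ⟩ in L²(Π), let χ solve (T*T + ε²) χ = u, and put φ =
u - ε²χ. The normal equation says precisely that ⟨A f, u⟩ - M(φ) is uncorrelated with every M(g). By
joint Gaussianity it is independent of M, so the posterior of ⟨A f, u⟩ is N(M(φ), ε²⟨φ, u⟩)
(`residual_law`, `map_posteriorLaw_ae_eq`). This holds almost surely for the marginal law of M and
passes to the law at f₀ by Cameron–Martin (`map_obs_absolutelyContinuous`).

After centring and scaling, the mean is ε⟨χ, A f₀⟩ + W(u) - W(φ) and the variance is ⟨φ, u⟩. Since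
ψ' lies in the RKHS, |⟨u, g⟩| ≤ K‖T g‖, hence ‖T χ‖ ≤ |K| and ε‖χ‖ ≤ |K| (`regularized_bounds`). So
ε²χ → 0, which settles the variance and the noise increment; the bias vanishes because εχ tends
weakly to 0 (`tendsto_mul_inner_regularized`). -/

namespace InverseBvM

/-! ### Tikhonov regularization of the normal equation -/

section Regularization

variable {H E : Type*} [NormedAddCommGroup H] [InnerProductSpace ℝ H]
  [NormedAddCommGroup E] [InnerProductSpace ℝ E]

/-- The Tikhonov-regularized normal equation `(T* T + t) χ = u` has a solution for `t > 0`. -/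
theorem exists_regularized_solution [CompleteSpace H] (T : H →L[ℝ] E) (u : H) {t : ℝ} (ht : 0 < t) :
    ∃ χ : H, ∀ g : H, ⟪T χ, T g⟫_ℝ + t * ⟪χ, g⟫_ℝ = ⟪u, g⟫_ℝ := by
  -- Lax–Milgram for this form, which is coercive with constant t.
  let B : H →L[ℝ] H →L[ℝ] ℝ :=
    (innerSL ℝ (E := E)).bilinearComp T T + t • (innerSL ℝ (E := H))
  have hB : ∀ v w, B v w = ⟪T v, T w⟫_ℝ + t * ⟪v, w⟫_ℝ := fun v w => rfl
  have hc : IsCoercive B := by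
    refine ⟨t, ht, fun v => ?_⟩
    rw [hB, real_inner_self_eq_norm_sq, real_inner_self_eq_norm_sq]
    nlinarith [sq_nonneg ‖T v‖]
  refine ⟨hc.continuousLinearEquivOfBilin.symm u, fun g => ?_⟩
  rw [← hB, ← hc.continuousLinearEquivOfBilin_apply, ContinuousLinearEquiv.apply_symm_apply]

variable {T : H →L[ℝ] E} {u χ : H} {K ε : ℝ}

/-- Testing the equation with χ itself gives ‖T χ‖² + ε²‖χ‖² = ⟨u, χ⟩ ≤ |K|‖T χ‖, and both bounds
follow. -/
theorem regularized_bounds (hK : ∀ g, |⟪u, g⟫_ℝ| ≤ K * ‖T g‖)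
    (hχ : ∀ g : H, ⟪T χ, T g⟫_ℝ + ε ^ 2 * ⟪χ, g⟫_ℝ = ⟪u, g⟫_ℝ) :
    ‖T χ‖ ≤ |K| ∧ |ε| * ‖χ‖ ≤ |K| := by
  have h1 := hχ χ
  rw [real_inner_self_eq_norm_sq, real_inner_self_eq_norm_sq] at h1
  have h2 : ⟪u, χ⟫_ℝ ≤ |K| * ‖T χ‖ :=
    (le_abs_self _).trans
      ((hK χ).trans (mul_le_mul_of_nonneg_right (le_abs_self K) (norm_nonneg _)))
  have h3 : (|ε| * ‖χ‖) ^ 2 = ε ^ 2 * ‖χ‖ ^ 2 := by rw [mul_pow, sq_abs]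
  have h4 : ‖T χ‖ ≤ |K| := by
    by_contra! h
    nlinarith [sq_nonneg (|ε| * ‖χ‖), abs_nonneg K, norm_nonneg (T χ)]
  refine ⟨h4, ?_⟩
  refine abs_le_of_sq_le_sq' ?_ (abs_nonneg K) |>.2
  nlinarith [abs_nonneg K, norm_nonneg (T χ)]

variable {χ : ℝ → H}

/-- If `u` lies in the range of `T*`, then `ε² (T* T + ε²)⁻¹ u → 0` as `ε → 0`. -/
theorem tendsto_sq_smul_regularized (hK : ∀ g, |⟪u, g⟫_ℝ| ≤ K * ‖T g‖)
    (hχ : ∀ ε > 0, ∀ g : H, ⟪T (χ ε), T g⟫_ℝ + ε ^ 2 * ⟪χ ε, g⟫_ℝ = ⟪u, g⟫_ℝ) :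
    Tendsto (fun ε => ε ^ 2 • χ ε) (𝓝[>] 0) (𝓝 0) := by
  have h0 : Tendsto (fun ε : ℝ => ε * |K|) (𝓝[>] 0) (𝓝 0) := by
    have : Tendsto (fun ε : ℝ => ε * |K|) (𝓝 0) (𝓝 (0 * |K|)) := tendsto_id.mul_const _
    rw [zero_mul] at this
    exact this.mono_left nhdsWithin_le_nhds
  refine squeeze_zero_norm' ?_ h0
  filter_upwards [self_mem_nhdsWithin] with ε hε
  have hε : 0 < ε := hε
  have h := (regularized_bounds hK (hχ ε hε)).2
  rw [abs_of_pos hε] at h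
  rw [norm_smul, Real.norm_of_nonneg (sq_nonneg ε), sq, mul_assoc]
  exact mul_le_mul_of_nonneg_left h hε.le

/-- If `u` lies in the range of `T*`, then `ε (T* T + ε²)⁻¹ u → 0` weakly as `ε → 0`. -/
theorem tendsto_mul_inner_regularized [CompleteSpace H] [CompleteSpace E]
    (hK : ∀ g, |⟪u, g⟫_ℝ| ≤ K * ‖T g‖)
    (hχ : ∀ ε > 0, ∀ g : H, ⟪T (χ ε), T g⟫_ℝ + ε ^ 2 * ⟪χ ε, g⟫_ℝ = ⟪u, g⟫_ℝ) (h : H) :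
    Tendsto (fun ε => ε * ⟪χ ε, h⟫_ℝ) (𝓝[>] 0) (𝓝 0) := by
  let R : Submodule ℝ H := (T.adjoint).range
  -- The orthogonal complement of the range of T* is ker T. There `hK` kills ⟨u, k⟩, and the
  -- equation then forces ⟨χ, k⟩ = 0, so only the closure of the range matters.
  have hker : ∀ k ∈ Rᗮ, ∀ ε > 0, ⟪χ ε, k⟫_ℝ = 0 := by
    intro k hk ε hε
    have hT : T k = 0 := by
      have h1 := hk (T.adjoint (T k)) ⟨T k, rfl⟩
      rwa [ContinuousLinearMap.adjoint_inner_left, inner_self_eq_zero] at h1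
    have h2 := hχ ε hε k
    have h3 := hK k
    rw [hT, norm_zero, mul_zero] at h3
    rw [hT, inner_zero_right, zero_add, abs_nonpos_iff.1 h3] at h2
    exact (mul_eq_zero.1 h2).resolve_left (by positivity)
  obtain ⟨y, hy, k, hk, rfl⟩ := R.topologicalClosure.exists_add_mem_mem_orthogonal h
  rw [Submodule.orthogonal_closure] at hk
  have hred : (fun ε => ε * ⟪χ ε, y⟫_ℝ) =ᶠ[𝓝[>] 0] fun ε => ε * ⟪χ ε, y + k⟫_ℝ := by
    filter_upwards [self_mem_nhdsWithin] with ε hε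
    rw [inner_add_right, hker k hk ε hε, add_zero]
  refine Tendsto.congr' hred ?_
  rw [Metric.tendsto_nhds]
  intro η hη
  -- On T* e the quantity is ε⟨T χ, e⟩, of order ε. The approximation error is multiplied by ε‖χ‖ ≤
  -- |K|, so this tolerance costs at most η/2; the +1 covers K = 0.
  obtain ⟨z, ⟨e, rfl⟩, hz⟩ := Metric.mem_closure_iff.1 hy (η / (2 * (|K| + 1))) (by positivity)
  have h0 : Tendsto (fun ε : ℝ => ε * (|K| * ‖e‖)) (𝓝[>] 0) (𝓝 0) := by
    have : Tendsto (fun ε : ℝ => ε * (|K| * ‖e‖)) (𝓝 0) (𝓝 (0 * (|K| * ‖e‖))) :=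
      tendsto_id.mul_const _
    rw [zero_mul] at this
    exact this.mono_left nhdsWithin_le_nhds
  filter_upwards [self_mem_nhdsWithin, h0.eventually (gt_mem_nhds (half_pos hη))] with ε hε hε2
  have hε : 0 < ε := hε
  obtain ⟨b1, b2⟩ := regularized_bounds hK (hχ ε hε)
  rw [abs_of_pos hε] at b2
  rw [Real.dist_eq, sub_zero]
  have e1 : ε * ⟪χ ε, y⟫_ℝ = ε * ⟪T (χ ε), e⟫_ℝ + ε * ⟪χ ε, y - T.adjoint e⟫_ℝ := by
    rw [inner_sub_right, ContinuousLinearMap.adjoint_inner_right]; ring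
  have e2 : |ε * ⟪T (χ ε), e⟫_ℝ| ≤ ε * (|K| * ‖e‖) := by
    rw [abs_mul, abs_of_pos hε]
    exact mul_le_mul_of_nonneg_left ((abs_real_inner_le_norm _ _).trans
      (mul_le_mul_of_nonneg_right b1 (norm_nonneg _))) hε.le
  have e3 : |ε * ⟪χ ε, y - T.adjoint e⟫_ℝ| ≤ |K| * (η / (2 * (|K| + 1))) := by
    rw [abs_mul, abs_of_pos hε]
    calc ε * |⟪χ ε, y - T.adjoint e⟫_ℝ| ≤ ε * (‖χ ε‖ * ‖y - T.adjoint e‖) :=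
          mul_le_mul_of_nonneg_left (abs_real_inner_le_norm _ _) hε.le
      _ = (ε * ‖χ ε‖) * ‖y - T.adjoint e‖ := by ring
      _ ≤ |K| * (η / (2 * (|K| + 1))) := by
          rw [dist_eq_norm] at hz
          exact mul_le_mul b2 hz.le (norm_nonneg _) (abs_nonneg _)
  have e4 : |K| * (η / (2 * (|K| + 1))) ≤ η / 2 := by
    rw [mul_div_assoc', div_le_div_iff₀ (by positivity) (by positivity)]
    nlinarith [abs_nonneg K]
  rw [e1]
  exact (abs_add_le _ _).trans_lt (by linarith)

end Regularization

/-! ### Continuity of Gaussian laws in mean and variance -/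

section GaussianReal

theorem gaussianReal_eq_map_standard (m : ℝ) (v : ℝ≥0) :
    gaussianReal m v = (gaussianReal 0 1).map (fun x => m + √v * x) := by
  have h : (fun x : ℝ => m + √v * x) = (fun x => m + x) ∘ fun x => √v * x := rfl
  rw [h, ← Measure.map_map (by fun_prop) (by fun_prop), gaussianReal_map_const_mul,
    gaussianReal_map_const_add]
  congr 1
  · simp
  · ext; simp

/-- `gaussianReal` as a bundled probability measure. -/
noncomputable def gaussianProbabilityMeasure (m : ℝ) (v : ℝ≥0) : ProbabilityMeasure ℝ :=
  ⟨gaussianReal m v, inferInstance⟩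

/-- All these laws are images of the one standard Gaussian under maps continuous in the parameters,
so dominated convergence applies; variance 0 needs no separate case. -/
theorem continuous_gaussianProbabilityMeasure :
    Continuous (fun p : ℝ × ℝ≥0 => gaussianProbabilityMeasure p.1 p.2) := by
  rw [continuous_iff_continuousAt]
  intro p
  refine ProbabilityMeasure.tendsto_iff_forall_integral_tendsto.2 fun f => ?_
  have h : ∀ q : ℝ × ℝ≥0, ∫ x, f x ∂(gaussianReal q.1 q.2)
      = ∫ x, f (q.1 + √q.2 * x) ∂(gaussianReal 0 1) := by
    intro q
    rw [gaussianReal_eq_map_standard, integral_map (by fun_prop)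
      f.continuous.aestronglyMeasurable]
  simp only [gaussianProbabilityMeasure, ProbabilityMeasure.coe_mk, h]
  have hc : Continuous fun q : ℝ × ℝ≥0 => ∫ x, f (q.1 + √q.2 * x) ∂(gaussianReal 0 1) := by
    refine continuous_of_dominated (bound := fun _ => ‖f‖) ?_ ?_ (integrable_const _) ?_
    · intro q
      exact (f.continuous.comp (by fun_prop)).aestronglyMeasurable
    · intro q
      exact ae_of_all _ fun x => f.norm_coe_le_norm _
    · exact ae_of_all _ fun x => f.continuous.comp (by fun_prop)
  exact hc.tendsto p

end GaussianReal

/-- Convergence in probability of random Gaussian laws with deterministic variance. -/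
theorem tendstoWeaklyInProbability_gaussianReal {Ω : Type*} [MeasurableSpace Ω] {P : Measure Ω}
    {μ : ℝ → Ω → ProbabilityMeasure ℝ} {m : ℝ → Ω → ℝ} {v : ℝ → ℝ≥0} {v₀ : ℝ≥0}
    (hμ : ∀ ε > 0, ∀ᵐ ω ∂P, (μ ε ω : Measure ℝ) = gaussianReal (m ε ω) (v ε))
    (hm : ∀ r > 0, Tendsto (fun ε => P {ω | r ≤ |m ε ω|}) (𝓝[>] 0) (𝓝 0))
    (hv : Tendsto v (𝓝[>] 0) (𝓝 v₀)) :
    TendstoWeaklyInProbability P μ (gaussianProbabilityMeasure 0 v₀) := by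
  intro d hd η hη
  set ν := gaussianProbabilityMeasure 0 v₀
  -- Only the topology of d enters: its ball is a neighbourhood of ν, whose preimage in parameter
  -- space contains a box around (0, v₀).
  have hball : {q | d.dist q ν < η} ∈ 𝓝 ν := by
    rw [← hd]
    exact @Metric.ball_mem_nhds _ d.toPseudoMetricSpace ν η hη
  have hpre := (continuous_gaussianProbabilityMeasure.tendsto ((0, v₀) : ℝ × ℝ≥0)) hball
  rw [mem_map, nhds_prod_eq, mem_prod_iff] at hpre
  obtain ⟨s, hs, t, ht, hst⟩ := hpre
  obtain ⟨r, hr, hrs⟩ := Metric.mem_nhds_iff.1 hs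
  refine tendsto_of_tendsto_of_tendsto_of_le_of_le' tendsto_const_nhds (hm r hr)
    (Eventually.of_forall fun _ => zero_le) ?_
  filter_upwards [self_mem_nhdsWithin, hv ht] with ε hε hεt
  refine measure_mono_ae ?_
  filter_upwards [hμ ε hε] with ω hω hdist
  by_contra hlt
  have hlt : |m ε ω| < r := not_le.1 hlt
  have hmem : (m ε ω, v ε) ∈ s ×ˢ t :=
    ⟨hrs (by rwa [Metric.mem_ball, Real.dist_eq, sub_zero]), hεt⟩
  have h1 := hst hmem
  have h2 : μ ε ω = gaussianProbabilityMeasure (m ε ω) (v ε) := Subtype.ext hω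
  have hdist : η ≤ d.dist (μ ε ω) ν := hdist
  rw [h2] at hdist
  exact absurd hdist (not_le.2 h1)

/-! ### White noise: covariance, projections and translates -/

section WhiteNoise

variable {H Ω : Type*} [NormedAddCommGroup H] [InnerProductSpace ℝ H]
  [MeasurableSpace Ω] {P : Measure Ω} {W : H → Ω → ℝ}

theorem IsWhiteNoise.memLp_two (hW : IsWhiteNoise W P) (φ : H) : MemLp (W φ) 2 P :=
  (hW.gaussian.hasGaussianLaw_eval φ).memLp_two

theorem IsWhiteNoise.cov_eq_inner (hW : IsWhiteNoise W P) (φ φ' : H) :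
    cov[W φ, W φ'; P] = ⟪φ, φ'⟫_ℝ := by
  have := hW.gaussian.isProbabilityMeasure
  rw [covariance_eq_sub (hW.memLp_two φ) (hW.memLp_two φ'), hW.mean_zero, hW.mean_zero,
    zero_mul, sub_zero, ← hW.covariance]
  rfl

theorem IsWhiteNoise.map_eq (hW : IsWhiteNoise W P) (φ : H) :
    P.map (W φ) = gaussianReal 0 (‖φ‖₊ ^ 2) := by
  rw [(hW.gaussian.hasGaussianLaw_eval φ).map_eq_gaussianReal, hW.mean_zero,
    ← covariance_self (hW.measurable φ).aemeasurable, hW.cov_eq_inner,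
    real_inner_self_eq_norm_sq]
  congr 1
  ext
  simp

theorem IsWhiteNoise.integral_sq_sub (hW : IsWhiteNoise W P) (φ φ' : H) :
    ∫ ω, (W φ ω - W φ' ω) ^ 2 ∂P = ‖φ - φ'‖ ^ 2 := by
  have i : ∀ a b, Integrable (fun ω => W a ω * W b ω) P := fun a b =>
    (hW.memLp_two a).integrable_mul (hW.memLp_two b)
  have e : ∀ ω, (W φ ω - W φ' ω) ^ 2
      = W φ ω * W φ ω - 2 * (W φ ω * W φ' ω) + W φ' ω * W φ' ω := fun ω => by ring
  have i₁ : Integrable (fun ω => W φ ω * W φ ω - 2 * (W φ ω * W φ' ω)) P :=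
    (i _ _).sub ((i _ _).const_mul 2)
  simp_rw [e]
  rw [integral_add i₁ (i _ _), integral_sub (i _ _) ((i _ _).const_mul 2), integral_const_mul,
    hW.covariance, hW.covariance, hW.covariance, norm_sub_sq_real,
    real_inner_self_eq_norm_sq, real_inner_self_eq_norm_sq]

/-- The part of the noise orthogonal to the direction `d` is independent of `W d`. -/
theorem IsWhiteNoise.indepFun_sub_proj (hW : IsWhiteNoise W P) {d : H} (hd : d ≠ 0) :
    IndepFun (fun ω φ => W φ ω - ⟪φ, d⟫_ℝ / ‖d‖ ^ 2 * W d ω) (W d) P := by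
  classical
  have := hW.gaussian.isProbabilityMeasure
  have hm := hW.measurable
  let X : H → Ω → ℝ := fun φ ω => W φ ω - ⟪φ, d⟫_ℝ / ‖d‖ ^ 2 * W d ω
  let Y : Unit → Ω → ℝ := fun _ => W d
  have hXY : IsGaussianProcess (Sum.elim X Y) P := by
    refine hW.gaussian.of_isGaussianProcess fun s => ?_
    cases s with
    | inl φ =>
      refine ⟨{φ, d}, ContinuousLinearMap.proj ⟨φ, by simp⟩
        - (⟪φ, d⟫_ℝ / ‖d‖ ^ 2) • ContinuousLinearMap.proj ⟨d, by simp⟩, fun ω => ?_⟩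
      simp [X]
    | inr _ =>
      refine ⟨{d}, ContinuousLinearMap.proj ⟨d, by simp⟩, fun ω => ?_⟩
      simp [Y]
  have hind := hXY.indepFun_of_covariance_eq_zero
    (fun s => Measurable.aemeasurable (by fun_prop)) (fun s => (hm d).aemeasurable) fun φ _ => by
      have h1 : cov[X φ, W d; P] = cov[W φ, W d; P]
          - cov[fun ω => ⟪φ, d⟫_ℝ / ‖d‖ ^ 2 * W d ω, W d; P] :=
        covariance_sub_left (hW.memLp_two φ) ((hW.memLp_two d).const_mul _) (hW.memLp_two d)
      change cov[X φ, W d; P] = 0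
      rw [h1, covariance_const_mul_left, hW.cov_eq_inner, hW.cov_eq_inner,
        real_inner_self_eq_norm_sq, div_mul_cancel₀ _ (by simpa using hd), sub_self]
  exact hind.comp measurable_id (measurable_pi_apply ())

/-- Cameron–Martin for white noise: translates by elements of `H` are mutually absolutely
continuous. -/
theorem IsWhiteNoise.map_translate_absolutelyContinuous (hW : IsWhiteNoise W P) {ε : ℝ}
    (hε : ε ≠ 0) (h h' : H) :
    P.map (fun ω (φ : H) => ⟪h, φ⟫_ℝ + ε * W φ ω)
      ≪ P.map (fun ω (φ : H) => ⟪h', φ⟫_ℝ + ε * W φ ω) := by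
  have := hW.gaussian.isProbabilityMeasure
  have hm := hW.measurable
  rcases eq_or_ne (h - h') 0 with hd | hd
  · rw [sub_eq_zero.1 hd]
  set d := h - h' with hdef
  have hd2 : ‖d‖ ^ 2 ≠ 0 := by simpa using hd
  have hv : ‖d‖₊ ^ 2 ≠ 0 := by simpa using hd
  let X : Ω → H → ℝ := fun ω φ => W φ ω - ⟪φ, d⟫_ℝ / ‖d‖ ^ 2 * W d ω
  have hX : Measurable X := measurable_pi_lambda _ fun φ => by fun_prop
  -- `F` rebuilds the observation centred at h' from the part of the noise orthogonal to d and the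
  -- scalar W d. Moving the centre to h only shifts that scalar by ‖d‖²/ε.
  let F : (H → ℝ) × ℝ → H → ℝ := fun p φ => ⟪h', φ⟫_ℝ + ε * (p.1 φ + ⟪φ, d⟫_ℝ / ‖d‖ ^ 2 * p.2)
  have hF : Measurable F := measurable_pi_lambda _ fun φ => by fun_prop
  have hind : IndepFun X (W d) P := hW.indepFun_sub_proj hd
  have hind' : IndepFun X (fun ω => W d ω + ‖d‖ ^ 2 / ε) P :=
    hind.comp measurable_id (measurable_add_const (‖d‖ ^ 2 / ε))
  have e1 : (fun ω (φ : H) => ⟪h', φ⟫_ℝ + ε * W φ ω) = F ∘ fun ω => (X ω, W d ω) := by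
    ext ω φ
    simp [F, X]
  have e2 : (fun ω (φ : H) => ⟪h, φ⟫_ℝ + ε * W φ ω)
      = F ∘ fun ω => (X ω, W d ω + ‖d‖ ^ 2 / ε) := by
    ext ω φ
    have : ⟪h, φ⟫_ℝ = ⟪h', φ⟫_ℝ + ⟪φ, d⟫_ℝ := by
      rw [hdef, inner_sub_right, real_inner_comm h, real_inner_comm h']; ring
    simp only [F, X, Function.comp_apply, this]
    field_simp
    ring
  have l1 : P.map (fun ω => (X ω, W d ω)) = (P.map X).prod (gaussianReal 0 (‖d‖₊ ^ 2)) := by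
    rw [(indepFun_iff_map_prod_eq_prod_map_map hX.aemeasurable (hm d).aemeasurable).1 hind,
      hW.map_eq]
  have l2 : P.map (fun ω => (X ω, W d ω + ‖d‖ ^ 2 / ε))
      = (P.map X).prod (gaussianReal (‖d‖ ^ 2 / ε) (‖d‖₊ ^ 2)) := by
    rw [(indepFun_iff_map_prod_eq_prod_map_map hX.aemeasurable (by fun_prop)).1 hind']
    congr 1
    have : (fun ω => W d ω + ‖d‖ ^ 2 / ε) = (fun x => x + ‖d‖ ^ 2 / ε) ∘ W d := rfl
    rw [this, ← Measure.map_map (by fun_prop) (hm d), hW.map_eq, gaussianReal_map_add_const,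
      zero_add]
  rw [e1, e2, ← Measure.map_map hF (by fun_prop), ← Measure.map_map hF (by fun_prop), l1, l2]
  -- The laws differ only in a nondegenerate Gaussian factor and its translate, both equivalent to
  -- Lebesgue measure.
  refine Measure.AbsolutelyContinuous.map (Measure.AbsolutelyContinuous.rfl.prod ?_) hF
  exact (gaussianReal_absolutelyContinuous _ hv).trans (gaussianReal_absolutelyContinuous' _ hv)

end WhiteNoise

/-! ### The RKHS bound and joint Gaussianity of parameter and noise -/

section CameronMartin

variable {V : Type*} [NormedAddCommGroup V] [InnerProductSpace ℝ V] [CompleteSpace V]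
  [SecondCountableTopology V] [MeasurableSpace V] [BorelSpace V]
  {prior : Measure V} [IsGaussian prior]

theorem norm_toLp_strongDual (l : StrongDual ℝ V) :
    ‖StrongDual.toLp prior 2 l‖ = (eLpNorm l 2 prior).toReal := by
  rw [StrongDual.toLp_apply (IsGaussian.memLp_two_id), Lp.norm_toLp]

/-- Evaluation at a point of the RKHS is bounded in the norm of `L²(Π)`. -/
theorem exists_abs_le_of_mem_rkhs {h : V} (hh : h ∈ rkhs prior) :
    ∃ K : ℝ, ∀ l : StrongDual ℝ V, |l h| ≤ K * ‖StrongDual.toLp prior 2 l‖ := by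
  have hfin : rkhsNorm prior h < ∞ := hh
  set K := (rkhsNorm prior h).toReal with hKdef
  have hK0 : 0 ≤ K := ENNReal.toReal_nonneg
  have hunit : ∀ l : StrongDual ℝ V, ‖StrongDual.toLp prior 2 l‖ ≤ 1 → l h ≤ K := by
    intro l hl
    have hl' : eLpNorm l 2 prior ≤ 1 := by
      rw [norm_toLp_strongDual] at hl
      have hne : eLpNorm l 2 prior ≠ ∞ := (IsGaussian.memLp_dual prior l 2 (by simp)).2.ne
      rwa [← ENNReal.toReal_le_toReal hne ENNReal.one_ne_top, ENNReal.toReal_one]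
    have h1 : ENNReal.ofReal (l h) ≤ rkhsNorm prior h :=
      le_iSup₂_of_le (f := fun (l : V →L[ℝ] ℝ) (_ : eLpNorm l 2 prior ≤ 1) =>
        ENNReal.ofReal (l h)) l hl' le_rfl
    exact (ENNReal.ofReal_le_iff_le_toReal hfin.ne).1 h1
  have hle : ∀ l : StrongDual ℝ V, l h ≤ K * ‖StrongDual.toLp prior 2 l‖ := by
    intro l
    set n := ‖StrongDual.toLp prior 2 l‖ with hn
    have hn0 : 0 ≤ n := norm_nonneg _
    -- Normalizing by n + s instead of n includes the functionals that vanish in L²(Π).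
    have hscale : ∀ s : ℝ, 0 < s → l h ≤ K * (n + s) := by
      intro s hs
      have hpos : 0 < n + s := by positivity
      have h2 := hunit ((n + s)⁻¹ • l) (by
        rw [map_smul, norm_smul, Real.norm_of_nonneg (by positivity), ← hn,
          inv_mul_le_iff₀ hpos]
        linarith)
      rw [smul_apply, smul_eq_mul, inv_mul_le_iff₀ hpos] at h2
      linarith
    refine le_of_forall_pos_le_add fun η hη => ?_
    have h3 := hscale (η / (K + 1)) (by positivity)
    have h4 : K * (η / (K + 1)) ≤ η := by
      rw [mul_div_assoc', div_le_iff₀ (by positivity)]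
      nlinarith
    linarith
  refine ⟨K, fun l => abs_le'.2 ⟨hle l, ?_⟩⟩
  have := hle (-l)
  rwa [map_neg, norm_neg, neg_apply] at this

variable {H Ω : Type*} [NormedAddCommGroup H] [InnerProductSpace ℝ H]
  [MeasurableSpace Ω] {P : Measure Ω} {W : H → Ω → ℝ}

/-- Continuous linear functionals of the parameter plus multiples of the noise are jointly
Gaussian when the parameter and the noise are independent. -/
theorem IsWhiteNoise.isGaussianProcess_dual_add (hW : IsWhiteNoise W P) {T : Type*}
    (l : T → StrongDual ℝ V) (a : T → ℝ) (φ : T → H) :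
    IsGaussianProcess (fun t (p : V × Ω) => l t p.1 + a t * W (φ t) p.2) (prior.prod P) := by
  classical
  have := hW.gaussian.isProbabilityMeasure
  have hm := hW.measurable
  refine ⟨fun I => ?_⟩
  let J := I.image φ
  have h1 : HasGaussianLaw (fun p : V × Ω => p.1) (prior.prod P) :=
    ⟨by rw [measurePreserving_fst.map_eq]; infer_instance⟩
  have h2 : HasGaussianLaw (fun p : V × Ω => J.restrict (W · p.2)) (prior.prod P) := by
    have hmeas : Measurable fun ω => J.restrict (W · ω) :=
      measurable_pi_lambda _ fun j => hm j
    refine ⟨?_⟩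
    have : (fun p : V × Ω => J.restrict (W · p.2))
        = (fun ω => J.restrict (W · ω)) ∘ Prod.snd := rfl
    rw [this, ← Measure.map_map hmeas measurable_snd, measurePreserving_snd.map_eq]
    exact (hW.gaussian.hasGaussianLaw J).isGaussian_map
  have hind : IndepFun (fun p : V × Ω => p.1) (fun p => J.restrict (W · p.2)) (prior.prod P) :=
    indepFun_prod (X := id) (Y := fun ω => J.restrict (W · ω)) measurable_id
      (measurable_pi_lambda _ fun j => hm j)
  have h3 := IndepFun.hasGaussianLaw h1 h2 hind
  -- A finite marginal is a continuous linear image of the Gaussian pair formed by f and the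
  -- finitely many noise coordinates involved.
  let L : V × (J → ℝ) →L[ℝ] (I → ℝ) := ContinuousLinearMap.pi fun t =>
    (l t).comp (ContinuousLinearMap.fst ℝ V (J → ℝ)) +
      a t • (ContinuousLinearMap.proj (R := ℝ) (φ := fun _ : J => ℝ)
        ⟨φ t, Finset.mem_image_of_mem φ t.2⟩).comp (ContinuousLinearMap.snd ℝ V (J → ℝ))
  exact h3.map L

theorem inner_toLp_strongDual (hprior : ∫ f, f ∂prior = 0) (l₁ l₂ : StrongDual ℝ V) :
    ⟪StrongDual.toLp prior 2 l₁, StrongDual.toLp prior 2 l₂⟫_ℝ = cov[l₁, l₂; prior] := by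
  have h : ∀ l : StrongDual ℝ V, MemLp l 2 prior := fun l =>
    IsGaussian.memLp_dual prior l 2 (by simp)
  rw [covariance_eq_sub (h _) (h _), IsGaussian.integral_dual, hprior, map_zero, zero_mul, sub_zero]
  exact uncenteredCovarianceBilinDual_apply IsGaussian.memLp_two_id l₁ l₂

/-- Independence removes the cross terms; centring of the prior identifies its covariance with the
L²(Π) inner product. -/
theorem IsWhiteNoise.covariance_dual_add (hW : IsWhiteNoise W P) (hprior : ∫ f, f ∂prior = 0)
    (l₁ l₂ : StrongDual ℝ V) (a₁ a₂ : ℝ) (φ₁ φ₂ : H) :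
    cov[fun p : V × Ω => l₁ p.1 + a₁ * W φ₁ p.2, fun p => l₂ p.1 + a₂ * W φ₂ p.2; prior.prod P]
      = ⟪StrongDual.toLp prior 2 l₁, StrongDual.toLp prior 2 l₂⟫_ℝ + a₁ * a₂ * ⟪φ₁, φ₂⟫_ℝ := by
  have := hW.gaussian.isProbabilityMeasure
  have hm := hW.measurable
  have hV : ∀ l : StrongDual ℝ V, MemLp l 2 prior := fun l =>
    IsGaussian.memLp_dual prior l 2 (by simp)
  have mV : ∀ l : StrongDual ℝ V, MemLp (fun p : V × Ω => l p.1) 2 (prior.prod P) := fun l =>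
    (hV l).comp_measurePreserving measurePreserving_fst
  have mW : ∀ (a : ℝ) (φ : H), MemLp (fun p : V × Ω => a * W φ p.2) 2 (prior.prod P) := fun a φ =>
    ((hW.memLp_two φ).const_mul a).comp_measurePreserving measurePreserving_snd
  have hVW : ∀ (l : StrongDual ℝ V) (a : ℝ) (φ : H),
      cov[fun p : V × Ω => l p.1, fun p => a * W φ p.2; prior.prod P] = 0 := fun l a φ =>
    (indepFun_prod (X := l) (Y := fun ω => a * W φ ω) (by fun_prop)
      (by fun_prop)).covariance_eq_zero (mV l) (mW a φ)
  have hVV : cov[fun p : V × Ω => l₁ p.1, fun p => l₂ p.1; prior.prod P] = cov[l₁, l₂; prior] := by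
    have h := covariance_map (μ := prior.prod P) (X := l₁) (Y := l₂) (Z := Prod.fst)
      (by fun_prop) (by fun_prop) (by fun_prop)
    rw [measurePreserving_fst.map_eq] at h
    exact h.symm
  have hWW : cov[fun p : V × Ω => a₁ * W φ₁ p.2, fun p => a₂ * W φ₂ p.2; prior.prod P]
      = a₁ * a₂ * ⟪φ₁, φ₂⟫_ℝ := by
    have h := covariance_map (μ := prior.prod P) (X := W φ₁) (Y := W φ₂) (Z := Prod.snd)
      (hm φ₁).aestronglyMeasurable (hm φ₂).aestronglyMeasurable (by fun_prop)
    rw [measurePreserving_snd.map_eq, hW.cov_eq_inner] at h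
    rw [covariance_const_mul_left, covariance_const_mul_right, mul_assoc, h]
    rfl
  have e1 := covariance_add_left (mV l₁) (mW a₁ φ₁) ((mV l₂).add (mW a₂ φ₂))
  have e2 := covariance_add_right (mV l₁) (mV l₂) (mW a₂ φ₂)
  have e3 := covariance_add_right (mW a₁ φ₁) (mV l₂) (mW a₂ φ₂)
  rw [e2, e3, hVV, hVW, hWW, covariance_comm (fun p : V × Ω => a₁ * W φ₁ p.2), hVW,
    ← inner_toLp_strongDual hprior, add_zero, zero_add] at e1
  exact e1

theorem IsWhiteNoise.integral_dual_add (hW : IsWhiteNoise W P) (hprior : ∫ f, f ∂prior = 0)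
    (l : StrongDual ℝ V) (a : ℝ) (φ : H) :
    ∫ p : V × Ω, l p.1 + a * W φ p.2 ∂(prior.prod P) = 0 := by
  have := hW.gaussian.isProbabilityMeasure
  rw [integral_add
    ((IsGaussian.integrable_dual prior l).comp_fst P)
    ((((hW.memLp_two φ).integrable one_le_two).const_mul a).comp_snd prior),
    integral_fun_fst (fun f => l f), integral_fun_snd (fun ω => a * W φ ω), integral_const_mul,
    hW.mean_zero, IsGaussian.integral_dual, hprior]
  simp

end CameronMartin

/-! ### Conditional laws and the posterior of a functional -/

/-- If `R` is independent of `Y`, the conditional law of `R + G Y` given `Y` is a translate of the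
law of `R`. -/
theorem ae_eq_map_add_of_indepFun {Ω 𝓨 : Type*} [MeasurableSpace Ω] [MeasurableSpace 𝓨]
    {Q : Measure Ω} [IsProbabilityMeasure Q] {Y : Ω → 𝓨} {R : Ω → ℝ} {G : 𝓨 → ℝ}
    (hY : Measurable Y) (hR : Measurable R) (hG : Measurable G) (hind : IndepFun Y R Q)
    {κ : Kernel 𝓨 ℝ} [IsFiniteKernel κ]
    (hκ : Q.map Y ⊗ₘ κ = Q.map (fun ω => (Y ω, R ω + G (Y ω)))) :
    ∀ᵐ y ∂(Q.map Y), κ y = (Q.map R).map (fun x => x + G y) := by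
  have : IsProbabilityMeasure (Q.map R) := Measure.isProbabilityMeasure_map hR.aemeasurable
  have : IsProbabilityMeasure (Q.map Y) := Measure.isProbabilityMeasure_map hY.aemeasurable
  have hg : Measurable fun p : 𝓨 × ℝ => p.2 + G p.1 := by fun_prop
  -- The candidate conditional law. It has the same joint law with Y as κ, and disintegrations are
  -- unique almost everywhere.
  let η : Kernel 𝓨 ℝ := (Kernel.id ×ₖ Kernel.const 𝓨 (Q.map R)).map fun p => p.2 + G p.1
  have hη : ∀ y, η y = (Q.map R).map (fun x => x + G y) := by
    intro y
    rw [Kernel.map_apply _ hg, Kernel.prod_apply, Kernel.id_apply, Kernel.const_apply,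
      Measure.dirac_prod, Measure.map_map hg (by fun_prop)]
    rfl
  have : IsMarkovKernel η := Kernel.IsMarkovKernel.map _ hg
  have hpair : Q.map Y ⊗ₘ η = Q.map (fun ω => (Y ω, R ω + G (Y ω))) := by
    have hm : Measurable fun p : 𝓨 × ℝ => (p.1, p.2 + G p.1) := by fun_prop
    have hcomp : (fun ω => (Y ω, R ω + G (Y ω)))
        = (fun p : 𝓨 × ℝ => (p.1, p.2 + G p.1)) ∘ fun ω => (Y ω, R ω) := rfl
    rw [hcomp, ← Measure.map_map hm (by fun_prop),
      (indepFun_iff_map_prod_eq_prod_map_map hY.aemeasurable hR.aemeasurable).1 hind]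
    ext s hs
    rw [Measure.compProd_apply hs, Measure.map_apply hm hs, Measure.prod_apply (hm hs)]
    refine lintegral_congr fun y => ?_
    rw [hη, Measure.map_apply (by fun_prop) (measurable_prodMk_left hs)]
    rfl
  filter_upwards [Kernel.ae_eq_of_compProd_eq (hκ.trans hpair.symm)] with y hy
  rw [hy, hη]

section Posterior

variable {V H Ω : Type*} [NormedAddCommGroup V] [InnerProductSpace ℝ V]
  [MeasurableSpace V] [BorelSpace V]
  [NormedAddCommGroup H] [InnerProductSpace ℝ H]
  [MeasurableSpace Ω] {P : Measure Ω} {W : H → Ω → ℝ}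
  {prior : Measure V} {A : V →L[ℝ] H}

/-- Realizes the Bayesian model on `prior.prod P`, where parameter and noise are independent
coordinates and Gaussian calculus is available. -/
theorem compProd_model [IsProbabilityMeasure P] [SFinite prior]
    (hW : ∀ φ, Measurable (W φ)) (ε : ℝ) :
    prior ⊗ₘ model A hW P ε = (prior.prod P).map (fun p => (p.1, obs A W ε p.1 p.2)) := by
  have hobs := measurable_obs A hW ε
  have hm : Measurable fun p : V × Ω => (p.1, obs A W ε p.1 p.2) := measurable_fst.prodMk hobs
  ext s hs
  rw [Measure.compProd_apply hs, Measure.map_apply hm hs, Measure.prod_apply (hm hs)]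
  refine lintegral_congr fun f => ?_
  have hf : Measurable (obs A W ε f) := hobs.comp measurable_prodMk_left
  change (P.map (obs A W ε f)) _ = _
  rw [Measure.map_apply hf (measurable_prodMk_left hs)]
  rfl

theorem comp_model [IsProbabilityMeasure P] [SFinite prior]
    (hW : ∀ φ, Measurable (W φ)) (ε : ℝ) :
    model A hW P ε ∘ₘ prior = (prior.prod P).map (fun p => obs A W ε p.1 p.2) := by
  have hobs := measurable_obs A hW ε
  rw [← Measure.snd_compProd, compProd_model, Measure.snd,
    Measure.map_map measurable_snd (measurable_fst.prodMk hobs)]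
  rfl

theorem compProd_posteriorLaw [IsProbabilityMeasure P] [CompleteSpace V]
    [SecondCountableTopology V] [IsFiniteMeasure prior] (hW : ∀ φ, Measurable (W φ)) (ε : ℝ) :
    (prior.prod P).map (fun p => obs A W ε p.1 p.2) ⊗ₘ posteriorLaw A hW P prior ε
      = (prior.prod P).map (fun p => (obs A W ε p.1 p.2, p.1)) := by
  have := standardBorelSpace_of_separable (E := V)
  have hobs := measurable_obs A hW ε
  have h : (model A hW P ε ∘ₘ prior) ⊗ₘ posteriorLaw A hW P prior ε
      = (prior ⊗ₘ model A hW P ε).map Prod.swap := compProd_posterior_eq_map_swap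
  rw [comp_model, compProd_model, Measure.map_map measurable_swap (measurable_fst.prodMk hobs)] at h
  exact h

/-- The law of the observation at any fixed parameter is absolutely continuous with respect to the
marginal law of the observation. -/
theorem map_obs_absolutelyContinuous [IsProbabilityMeasure P] [IsProbabilityMeasure prior]
    (hW : IsWhiteNoise W P) {ε : ℝ} (hε : ε ≠ 0) (f₀ : V) :
    P.map (obs A W ε f₀) ≪ (prior.prod P).map (fun p => obs A W ε p.1 p.2) := by
  rw [← comp_model hW.measurable]
  refine Measure.AbsolutelyContinuous.mk fun s hs hs0 => ?_
  rw [Measure.bind_apply hs (Kernel.aemeasurable _),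
    lintegral_eq_zero_iff (Kernel.measurable_coe _ hs)] at hs0
  -- A null set of the marginal is null for P_f at almost every f, hence at some f; Cameron–Martin
  -- carries this from f to f₀.
  obtain ⟨f, hf⟩ := hs0.exists
  exact hW.map_translate_absolutelyContinuous hε (A f₀) (A f) hf

/-- The map `χ ↦ ⟪A ·, χ⟫` from the data space to `L²(Π)`. -/
noncomputable def dataToLp (A : V →L[ℝ] H) (prior : Measure V) : H →L[ℝ] Lp ℝ 2 prior :=
  (StrongDual.toLp prior 2).comp
    (((ContinuousLinearMap.compL ℝ V H ℝ).flip A).comp (innerSL ℝ (E := H)))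

theorem dataToLp_apply (χ : H) :
    dataToLp A prior χ = StrongDual.toLp prior 2 ((innerSL ℝ χ).comp A) := rfl

variable [CompleteSpace V] [SecondCountableTopology V] [IsGaussian prior] {ε : ℝ} {u χ : H}

/-- Residual of the regularized linear predictor: Gaussian, and independent of the observation. -/
theorem residual_law (hW : IsWhiteNoise W P) (hprior : ∫ f, f ∂prior = 0)
    (hχ : ∀ g, ⟪dataToLp A prior χ, dataToLp A prior g⟫_ℝ + ε ^ 2 * ⟪χ, g⟫_ℝ = ⟪u, g⟫_ℝ) :
    IndepFun (fun p : V × Ω => obs A W ε p.1 p.2)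
        (fun p => ⟪A p.1, u⟫_ℝ - obs A W ε p.1 p.2 (u - ε ^ 2 • χ)) (prior.prod P) ∧
      (prior.prod P).map (fun p => ⟪A p.1, u⟫_ℝ - obs A W ε p.1 p.2 (u - ε ^ 2 • χ))
        = gaussianReal 0 (ε ^ 2 * ⟪u - ε ^ 2 • χ, u⟫_ℝ).toNNReal := by
  have hm := hW.measurable
  set φ := u - ε ^ 2 • χ with hφ
  let l : H → StrongDual ℝ V := fun g => (innerSL ℝ g).comp A
  have hl : ∀ g f, l g f = ⟪A f, g⟫_ℝ := fun g f => real_inner_comm _ _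
  -- One Gaussian process holding every M(g) and the residual, which equals ε²⟨A f, χ⟩ - ε W(φ)
  -- because u = φ + ε²χ.
  let Z : H ⊕ Unit → V × Ω → ℝ := fun t p =>
    Sum.elim l (fun _ => ε ^ 2 • l χ) t p.1
      + Sum.elim (fun _ => ε) (fun _ => -ε) t * W (Sum.elim id (fun _ => φ) t) p.2
  have hZ : IsGaussianProcess Z (prior.prod P) := hW.isGaussianProcess_dual_add _ _ _
  have hZl : ∀ g, Z (Sum.inl g) = fun p => obs A W ε p.1 p.2 g := by
    intro g
    ext p
    simp only [Z, Sum.elim_inl, hl, obs, id]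
  have hZr : Z (Sum.inr ()) = fun p => ⟪A p.1, u⟫_ℝ - obs A W ε p.1 p.2 φ := by
    ext p
    simp only [Z, Sum.elim_inr, obs, smul_apply, hl, smul_eq_mul]
    rw [show u = φ + ε ^ 2 • χ by rw [hφ]; abel, inner_add_right, real_inner_smul_right]
    ring
  have hZm : ∀ t, Measurable (Z t) := fun t => by
    have := hm (Sum.elim id (fun _ => φ) t)
    fun_prop
  -- The covariance is ε²⟨T g, T χ⟩ - ε²⟨g, φ⟩, and the normal equation reads ⟨T χ, T g⟩ = ⟨φ, g⟩.
  have hcov : ∀ g, cov[Z (Sum.inl g), Z (Sum.inr ()); prior.prod P] = 0 := by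
    intro g
    have h := hW.covariance_dual_add hprior (l g) (ε ^ 2 • l χ) ε (-ε) g φ
    rw [map_smul, real_inner_smul_right] at h
    have h2 := hχ g
    rw [dataToLp_apply, dataToLp_apply] at h2
    refine Eq.trans h ?_
    rw [real_inner_comm, hφ, inner_sub_right, real_inner_smul_right, real_inner_comm u g,
      real_inner_comm χ g, ← h2]
    ring
  have hsum : Sum.elim (fun g => Z (Sum.inl g)) (fun b => Z (Sum.inr b)) = Z := by
    ext t
    cases t <;> rfl
  constructor
  · have hind := IsGaussianProcess.indepFun_of_covariance_eq_zero
      (X := fun g => Z (Sum.inl g)) (Y := fun b => Z (Sum.inr b)) (by rwa [hsum])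
      (fun g => (hZm _).aemeasurable) (fun _ => (hZm _).aemeasurable) (fun g _ => hcov g)
    have h := hind.comp measurable_id (measurable_pi_apply ())
    have e1 : (fun p : V × Ω => obs A W ε p.1 p.2) = fun p g => Z (Sum.inl g) p := by
      ext p g
      rw [hZl]
    rw [← hZr, e1]
    exact h
  · rw [← hZr, (hZ.hasGaussianLaw_eval _).map_eq_gaussianReal,
      ← covariance_self (hZm _).aemeasurable]
    congr 1
    · exact hW.integral_dual_add hprior (ε ^ 2 • l χ) (-ε) φ
    · congr 1
      have h := hW.covariance_dual_add hprior (ε ^ 2 • l χ) (ε ^ 2 • l χ) (-ε) (-ε) φ φ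
      refine Eq.trans h ?_
      have h2 := hχ χ
      rw [dataToLp_apply] at h2
      -- The normal equation at g = χ. It turns the variance ε⁴‖T χ‖² + ε²‖φ‖² into ε²⟨φ, ε²χ + φ⟩ =
      -- ε²⟨φ, u⟩.
      have h3 : ⟪StrongDual.toLp prior 2 (l χ), StrongDual.toLp prior 2 (l χ)⟫_ℝ = ⟪φ, χ⟫_ℝ := by
        rw [hφ, inner_sub_left, real_inner_smul_left, ← h2]
        ring
      rw [map_smul, real_inner_smul_right, real_inner_smul_left, h3,
        show u = φ + ε ^ 2 • χ by rw [hφ]; abel, inner_add_right, real_inner_smul_right]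
      ring

/-- The posterior law of the functional `⟪A ·, u⟫` is Gaussian, centred at the regularized linear
predictor. -/
theorem map_posteriorLaw_ae_eq [IsProbabilityMeasure P] (hW : IsWhiteNoise W P)
    (hprior : ∫ f, f ∂prior = 0)
    (hχ : ∀ g, ⟪dataToLp A prior χ, dataToLp A prior g⟫_ℝ + ε ^ 2 * ⟪χ, g⟫_ℝ = ⟪u, g⟫_ℝ) :
    ∀ᵐ y ∂((prior.prod P).map fun p => obs A W ε p.1 p.2),
      (posteriorLaw A hW.measurable P prior ε y).map (fun f => ⟪A f, u⟫_ℝ)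
        = gaussianReal (y (u - ε ^ 2 • χ)) (ε ^ 2 * ⟪u - ε ^ 2 • χ, u⟫_ℝ).toNNReal := by
  obtain ⟨hind, hlaw⟩ := residual_law hW hprior hχ
  have hobs := measurable_obs A hW.measurable ε
  have hX : Measurable fun f : V => ⟪A f, u⟫_ℝ :=
    (A.continuous.inner continuous_const).measurable
  have hG : Measurable fun y : H → ℝ => y (u - ε ^ 2 • χ) := measurable_pi_apply _
  have : IsMarkovKernel ((posteriorLaw A hW.measurable P prior ε).map fun f => ⟪A f, u⟫_ℝ) :=
    Kernel.IsMarkovKernel.map _ hX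
  have hae := ae_eq_map_add_of_indepFun
    (R := fun p => ⟪A p.1, u⟫_ℝ - obs A W ε p.1 p.2 (u - ε ^ 2 • χ))
    (G := fun y : H → ℝ => y (u - ε ^ 2 • χ))
    (κ := (posteriorLaw A hW.measurable P prior ε).map fun f => ⟪A f, u⟫_ℝ)
    hobs ((hX.comp measurable_fst).sub (hG.comp hobs)) hG hind (by
      rw [Measure.compProd_map hX, compProd_posteriorLaw,
        Measure.map_map (measurable_id.prodMap hX) (hobs.prodMk measurable_fst)]
      congr 1
      ext p : 1
      simp)
  filter_upwards [hae] with y hy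
  rw [Kernel.map_apply _ hX, hlaw, gaussianReal_map_add_const, zero_add] at hy
  exact hy

end Posterior

/-! ### Source condition, Chebyshev bounds and conclusion -/

/-- Moving the adjoint across gives the identity on W₁; both sides are continuous, so density
extends it. -/
theorem pairing_eq_neg_inner {W₁ V H : Type*} [NormedAddCommGroup W₁] [InnerProductSpace ℝ W₁]
    [CompleteSpace W₁] [NormedAddCommGroup V] [InnerProductSpace ℝ V]
    [NormedAddCommGroup H] [InnerProductSpace ℝ H] [CompleteSpace H]
    {A₁ : W₁ →L[ℝ] H} {ι : W₁ →ₗ[ℝ] V} (hιd : DenseRange ι) {A : V →L[ℝ] H}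
    (hA : ∀ f, A (ι f) = A₁ f) {ψ : W₁} (hψ : ∃ C : ℝ, ∀ φ : W₁, |⟪ψ, φ⟫_ℝ| ≤ C * ‖ι φ‖) {ψ' : V}
    (hsource : ψ = -(ContinuousLinearMap.adjoint A₁ (A ψ'))) (f : V) :
    pairing ι ψ f = -⟪A f, A ψ'⟫_ℝ := by
  obtain ⟨C, hC⟩ := hψ
  have h : pairing ι ψ = -((innerSL ℝ (A ψ')).comp A) := by
    refine LinearMap.extendOfNorm_unique hιd C hC _ ?_
    ext φ
    change -⟪A ψ', A (ι φ)⟫_ℝ = ⟪ψ, φ⟫_ℝ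
    rw [hsource, inner_neg_left, ContinuousLinearMap.adjoint_inner_left, hA]
  rw [h, real_inner_comm]
  rfl

/-- Chebyshev's inequality for increments of white noise. -/
theorem IsWhiteNoise.measure_le_abs_sub {H Ω : Type*} [NormedAddCommGroup H]
    [InnerProductSpace ℝ H] [MeasurableSpace Ω] {P : Measure Ω} {W : H → Ω → ℝ}
    (hW : IsWhiteNoise W P) (φ φ' : H) {r : ℝ} (hr : 0 < r) :
    P {ω | r ≤ |W φ ω - W φ' ω|} ≤ ENNReal.ofReal (‖φ - φ'‖ ^ 2 / r ^ 2) := by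
  have := hW.gaussian.isProbabilityMeasure
  have hint : Integrable (fun ω => (W φ ω - W φ' ω) ^ 2) P :=
    ((hW.memLp_two φ).sub (hW.memLp_two φ')).integrable_sq
  have h := mul_meas_ge_le_integral_of_nonneg (μ := P)
    (ae_of_all _ fun ω => sq_nonneg (W φ ω - W φ' ω)) hint (r ^ 2)
  rw [hW.integral_sq_sub, mul_comm] at h
  have hset : {ω | r ≤ |W φ ω - W φ' ω|} = {ω | r ^ 2 ≤ (W φ ω - W φ' ω) ^ 2} := by
    ext ω
    change r ≤ |_| ↔ r ^ 2 ≤ _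
    rw [sq_le_sq, abs_of_pos hr]
  rw [hset, ← ofReal_measureReal]
  exact ENNReal.ofReal_le_ofReal ((le_div_iff₀ (by positivity)).2 h)

/-- The deterministic part is eventually below r/2, and the noise increment has variance ‖ρ ε‖² → 0.
-/
theorem tendsto_measure_le_abs_add {H Ω : Type*} [NormedAddCommGroup H]
    [InnerProductSpace ℝ H] [MeasurableSpace Ω] {P : Measure Ω} {W : H → Ω → ℝ}
    (hW : IsWhiteNoise W P) {b : ℝ → ℝ} {ρ : ℝ → H} {u : H} (hb : Tendsto b (𝓝[>] 0) (𝓝 0))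
    (hρ : Tendsto ρ (𝓝[>] 0) (𝓝 0)) {r : ℝ} (hr : 0 < r) :
    Tendsto (fun ε => P {ω | r ≤ |b ε + (W u ω - W (u - ρ ε) ω)|}) (𝓝[>] 0) (𝓝 0) := by
  have hlim : Tendsto (fun ε => ENNReal.ofReal (‖ρ ε‖ ^ 2 / (r / 2) ^ 2)) (𝓝[>] 0) (𝓝 0) := by
    have h := ENNReal.tendsto_ofReal ((hρ.norm.pow 2).div_const ((r / 2) ^ 2))
    simpa using h
  refine tendsto_of_tendsto_of_tendsto_of_le_of_le' tendsto_const_nhds hlim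
    (Eventually.of_forall fun _ => zero_le) ?_
  have hsmall : ∀ᶠ ε in 𝓝[>] 0, |b ε| < r / 2 :=
    hb.abs.eventually (gt_mem_nhds (by simpa using hr))
  filter_upwards [hsmall] with ε hε
  have hc := hW.measure_le_abs_sub u (u - ρ ε) (half_pos hr)
  rw [sub_sub_cancel] at hc
  refine (measure_mono fun ω hω => ?_).trans hc
  have hω : r ≤ |b ε + (W u ω - W (u - ρ ε) ω)| := hω
  change r / 2 ≤ _
  have := abs_add_le (b ε) (W u ω - W (u - ρ ε) ω)
  linarith

end InverseBvM

/-- Bernstein–von Mises theorem for linear functionals in a Gaussian linear inverse problem. The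
posterior law of the functional is Gaussian, with mean and variance given by the regularized normal
equation; the source condition alone makes the bias vanish, so the concentration-function condition
is not used. -/
theorem mainTheorem1
    {W₁ W₂ Wbar Ω : Type*}
    [NormedAddCommGroup W₁] [InnerProductSpace ℝ W₁] [CompleteSpace W₁]
    [TopologicalSpace.SeparableSpace W₁]
    [NormedAddCommGroup W₂] [InnerProductSpace ℝ W₂] [CompleteSpace W₂]
    [TopologicalSpace.SeparableSpace W₂]
    [NormedAddCommGroup Wbar] [InnerProductSpace ℝ Wbar] [CompleteSpace Wbar]
    [TopologicalSpace.SeparableSpace Wbar] [MeasurableSpace Wbar] [BorelSpace Wbar]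
    [MeasurableSpace Ω] (P : Measure Ω) [IsProbabilityMeasure P]
    -- the forward operator on `W₁`
    (A : W₁ →L[ℝ] W₂) (hA : Function.Injective A)
    -- `W₁` as a dense subspace of the enlarged space `Wbar`
    (ι : W₁ →ₗ[ℝ] Wbar) (hι : Function.Injective ι) (hιd : DenseRange ι)
    -- the forward operator on `Wbar`
    (Abar : Wbar →L[ℝ] W₂) (hAbar : ∀ f : W₁, Abar (ι f) = A f)
    (c : ℝ) (hc : 0 < c) (hAc : ∀ f : Wbar, ‖Abar f‖ ≤ c * ‖f‖)
    -- the noise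
    (W : W₂ → Ω → ℝ) (hW : InverseBvM.IsWhiteNoise W P)
    -- the prior and the truth
    (prior : Measure Wbar) [IsGaussian prior] (hprior : ∫ f, f ∂prior = 0)
    (f₀ : Wbar) (hcond : InverseBvM.ConcentrationCondition prior f₀ c)
    -- the test function
    (ψ : W₁) (hψ : ∃ C : ℝ, ∀ φ : W₁, |⟪ψ, φ⟫_ℝ| ≤ C * ‖ι φ‖)
    (ψ' : Wbar) (hψ' : ψ' ∈ InverseBvM.rkhs prior)
    (hsource : ψ = -(ContinuousLinearMap.adjoint A (Abar ψ'))) :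
    InverseBvM.TendstoWeaklyInProbability P
      (InverseBvM.scaledPosterior ι Abar hW.measurable P prior f₀ ψ ψ')
      (⟨gaussianReal 0 (‖Abar ψ'‖₊ ^ 2), inferInstance⟩ : ProbabilityMeasure ℝ) := by
  open InverseBvM in
  have := UniformSpace.secondCountable_of_separable Wbar
  set u := Abar ψ'
  let T := dataToLp Abar prior
  obtain ⟨K, hK⟩ := exists_abs_le_of_mem_rkhs hψ'
  -- The functional f ↦ ⟨g, A f⟩ takes the value ⟨g, u⟩ at ψ' and has L²(Π) norm ‖T g‖.
  have hKT : ∀ g, |⟪u, g⟫_ℝ| ≤ K * ‖T g‖ := fun g => by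
    have h := hK ((innerSL ℝ g).comp Abar)
    rwa [real_inner_comm]
  have hsol : ∀ ε : ℝ, ∃ χ : W₂, 0 < ε →
      ∀ g, ⟪T χ, T g⟫_ℝ + ε ^ 2 * ⟪χ, g⟫_ℝ = ⟪u, g⟫_ℝ := by
    intro ε
    by_cases hε : 0 < ε
    · obtain ⟨χ, hχ⟩ := exists_regularized_solution T u (pow_pos hε 2)
      exact ⟨χ, fun _ => hχ⟩
    · exact ⟨0, fun h => absurd h hε⟩
  choose χ hχ using hsol
  have hρ := tendsto_sq_smul_regularized hKT hχ
  have hbias := tendsto_mul_inner_regularized hKT hχ (Abar f₀)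
  have hpair : ∀ f, pairing ι ψ f = -⟪Abar f, u⟫_ℝ := pairing_eq_neg_inner hιd hAbar hψ hsource
  refine tendstoWeaklyInProbability_gaussianReal
    (m := fun ε ω => ε * ⟪χ ε, Abar f₀⟫_ℝ + (W u ω - W (u - ε ^ 2 • χ ε) ω))
    (v := fun ε => (⟪u - ε ^ 2 • χ ε, u⟫_ℝ).toNNReal) ?_
    (fun r hr => tendsto_measure_le_abs_add hW hbias hρ hr) ?_
  · intro ε hε
    have hobs : Measurable (obs Abar W ε f₀) :=
      (measurable_obs Abar hW.measurable ε).comp measurable_prodMk_left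
    -- The posterior formula, known almost surely for the marginal law, is transferred to the data
    -- generated at f₀.
    have hae := ae_of_ae_map hobs.aemeasurable
      ((map_obs_absolutelyContinuous hW hε.ne' f₀).ae_le
        (map_posteriorLaw_ae_eq hW hprior (hχ ε hε)))
    filter_upwards [hae] with ω hω
    have hX : Measurable fun f : Wbar => ⟪Abar f, u⟫_ℝ :=
      (Abar.continuous.inner continuous_const).measurable
    set a := centring ι Abar W f₀ ψ ψ' ε ω with ha
    have hfun : (fun f => ε⁻¹ * (pairing ι ψ f - a))
        = (fun x => ε⁻¹ * x) ∘ (fun x => x - a) ∘ (fun x => -x) ∘ fun f => ⟪Abar f, u⟫_ℝ := by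
      ext f
      simp only [Function.comp_apply, hpair]
    change (posteriorLaw Abar hW.measurable P prior ε (obs Abar W ε f₀ ω)).map
      (fun f => ε⁻¹ * (pairing ι ψ f - a)) = _
    rw [hfun, ← Measure.map_map (by fun_prop) (by fun_prop),
      ← Measure.map_map (by fun_prop) (by fun_prop), ← Measure.map_map (by fun_prop) hX, hω,
      gaussianReal_map_neg, gaussianReal_map_sub_const, gaussianReal_map_const_mul]
    congr 1
    -- The term ⟨A f₀, u⟩ cancels against the centring, leaving ε⁻¹⟨ε²χ, A f₀⟩ and the noise
    -- increment.
    · rw [ha, centring, hpair, obs, inner_sub_right, real_inner_smul_right,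
        real_inner_comm (Abar f₀) (χ ε)]
      field_simp
      ring
    · rw [Real.toNNReal_mul (sq_nonneg ε), ← mul_assoc]
      convert one_mul _
      ext
      rw [NNReal.coe_mul, Real.coe_toNNReal _ (sq_nonneg ε)]
      change (ε⁻¹) ^ 2 * ε ^ 2 = 1
      rw [← mul_pow, inv_mul_cancel₀ hε.ne', one_pow]
  · have h1 : Tendsto (fun ε => ⟪u - ε ^ 2 • χ ε, u⟫_ℝ) (𝓝[>] 0) (𝓝 ⟪u - 0, u⟫_ℝ) :=
      (tendsto_const_nhds.sub hρ).inner tendsto_const_nhds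
    have h2 := (continuous_real_toNNReal.tendsto _).comp h1
    have h3 : (⟪u - 0, u⟫_ℝ).toNNReal = ‖u‖₊ ^ 2 := by
      rw [sub_zero, real_inner_self_eq_norm_sq]
      ext
      simp
    rwa [h3] at h2
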